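/- A function $h:\mathbb{R}^n\to\mathbb{R}$ is additive if $h(x)+h(y)=h(x+y)$ for all $x,y\in\mathbb{R}^n$. A probability distribution $\mathcal{D}$ on $\mathbb{R}^n$ is $(\eta,R)$-concentrated if $\Pr_{p\sim\mathcal{D}}[\|p\|_2<R]\ge 1-\eta$. A tester is a randomized algorithm with (adaptive) query access to a measurable function $f:\mathbb{R}^n\to\mathbb{R}$ and access to independent samples from a distribution $\mathcal{D}$, which at the end accepts or rejects. Theorem. There are absolute constants $C,K>0$ such that for all $n\in\mathbb{N}$ and real $\alpha,\varepsilon>0$ and $R$ with $R\,n^{1.5}\ge 1$ there is a tester, depending only on $n,\alpha,\varepsilon,R$, that makes at most $C/\varepsilon$ calls in total to its two oracles (in particular $O(1/\varepsilon)$ queries to $f$), and such that for every measurable $f:\mathbb{R}^n\to\mathbb{R}$ and every (unknown) $(\varepsilon/4,R)$-concentrated probability distribution $\mathcal{D}$ on $\mathbb{R}^n$: 1. (one-sided error) if $f$ is pointwise $\alpha$-close to some additive function, that is, if there is an additive $h$ with $|f(x)-h(x)|\le\alpha$ for all $x\in\mathbb{R}^n$, then the tester accepts $f$ with probability $1$;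 2. if for every additive function $h:\mathbb{R}^n\to\mathbb{R}$ $$\Pr_{p\sim\mathcal{D}}\bigl[\,|f(p)-h(p)|>K\,R\,n^{1.5}\,\alpha\,\bigr]>\varepsilon,$$ then the tester rejects $f$ with probability at least $2/3$. -/

import Mathlib

open MeasureTheory

/-- A randomized algorithm on functions `f : ℝⁿ → ℝ` with query access to `f` and sample access to
a probability distribution on `ℝⁿ`. It tosses its internal coins, receives `numSamples`
independent samples, and then makes `numQueries` adaptive queries to `f`: the point of query number
`k` (counted from `0`) is a measurable function of the coins, the samples and the answers to the
previous `k` queries. At the end it accepts or rejects. Neither `f` nor the distribution is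
available to it in any other way. -/
structure Tester (n : ℕ) where
  /-- the number of samples drawn from the unknown distribution -/
  numSamples : ℕ
  /-- the number of queries made to the unknown function -/
  numQueries : ℕ
  /-- the space of internal coin tosses -/
  Coins : Type
  coinsMeasurableSpace : MeasurableSpace Coins
  /-- the law of the internal coin tosses -/
  coinLaw : Measure Coins
  coinLaw_isProbabilityMeasure : IsProbabilityMeasure coinLaw
  /-- the next query point, given the coins, the samples and the first `k` answers
  (only the values for `k < numQueries` matter) -/
  query : (k : ℕ) → Coins × (Fin numSamples → EuclideanSpace ℝ (Fin n)) × (Fin k → ℝ) →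
    EuclideanSpace ℝ (Fin n)
  measurable_query : ∀ k, Measurable (query k)
  /-- the set of coins, samples and answers that make the algorithm accept -/
  acceptSet : Set (Coins × (Fin numSamples → EuclideanSpace ℝ (Fin n)) × (Fin numQueries → ℝ))
  measurableSet_acceptSet : MeasurableSet acceptSet

namespace Tester

attribute [instance] Tester.coinsMeasurableSpace Tester.coinLaw_isProbabilityMeasure

variable {n : ℕ}

/-- The answers to the first `k` queries, when the queried function is `f`, the coins are `z.1` and
the samples are `z.2`. -/
def answers (T : Tester n) (f : EuclideanSpace ℝ (Fin n) → ℝ)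
    (z : T.Coins × (Fin T.numSamples → EuclideanSpace ℝ (Fin n))) : (k : ℕ) → Fin k → ℝ
  | 0 => Fin.elim0
  | k + 1 => Fin.snoc (T.answers f z k) (f (T.query k (z.1, z.2, T.answers f z k)))

/-- The event that `T` accepts `f`. -/
def acceptEvent (T : Tester n) (f : EuclideanSpace ℝ (Fin n) → ℝ) :
    Set (T.Coins × (Fin T.numSamples → EuclideanSpace ℝ (Fin n))) :=
  {z | (z.1, z.2, T.answers f z T.numQueries) ∈ T.acceptSet}

/-- The joint law of the internal coins and of `numSamples` independent samples from `D`. -/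
noncomputable def runLaw (T : Tester n) (D : Measure (EuclideanSpace ℝ (Fin n))) :
    Measure (T.Coins × (Fin T.numSamples → EuclideanSpace ℝ (Fin n))) :=
  T.coinLaw.prod (Measure.pi fun _ => D)

/-- The probability that `T` accepts `f` when the samples come from `D`. -/
noncomputable def acceptProb (T : Tester n) (f : EuclideanSpace ℝ (Fin n) → ℝ)
    (D : Measure (EuclideanSpace ℝ (Fin n))) : ℝ :=
  (T.runLaw D).real (T.acceptEvent f)

/-- The probability that `T` rejects `f` when the samples come from `D`. -/
noncomputable def rejectProb (T : Tester n) (f : EuclideanSpace ℝ (Fin n) → ℝ)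
    (D : Measure (EuclideanSpace ℝ (Fin n))) : ℝ :=
  (T.runLaw D).real (T.acceptEvent f)ᶜ

end Tester

/-- `D` is `(ε, R)`-concentrated: the open Euclidean ball of radius `R` around the origin has
`D`-probability at least `1 - ε`. -/
def IsConcentrated {n : ℕ} (D : Measure (EuclideanSpace ℝ (Fin n))) (ε R : ℝ) : Prop :=
  1 - ε ≤ D.real (Metric.ball 0 R)

/-- `f` is pointwise `α`-close to some additive function. -/
def IsCloseToAdditive {n : ℕ} (f : EuclideanSpace ℝ (Fin n) → ℝ) (α : ℝ) : Prop :=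
  ∃ h : EuclideanSpace ℝ (Fin n) →+ ℝ, ∀ x, |f x - h x| ≤ α

/-- Every additive function differs from `f` by more than `β` with `D`-probability more
than `ε`. -/
def IsFarFromAdditive {n : ℕ} (f : EuclideanSpace ℝ (Fin n) → ℝ)
    (D : Measure (EuclideanSpace ℝ (Fin n))) (β ε : ℝ) : Prop :=
  ∀ h : EuclideanSpace ℝ (Fin n) →+ ℝ, ε < D.real {p | β < |f p - h p|}

/-! Each round draws `x, y` from a distribution `μ` on a huge ball, almost invariant under short
translations, draws a sample `p`, and checks additivity at `(x, y)` and `(p, x)` up to `3 * α`. A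
function `α`-close to additive always passes, by the triangle inequality. For soundness, suppose the
check at `(x, y)` rarely fails. Then, for every `p` in a ball of radius `ρ`, the difference `f (p +
x) - f x` concentrates near a value `g p` as `x` varies (`exists_concentrated_difference`), and `g`
is additive on that ball up to `18 * α` (`abs_concentrated_difference_le`). A local form of Hyers'
theorem (`exists_addMonoidHom_of_locally_approx_additive`) gives an additive `h` within `36 * α` of
`g` on the `R`-ball. Where `f p` is far from `h p`, it is far from `g p`, so the check at `(p, x)`
usually fails. Since `ρ` may depend on `n`, no dimension factor is lost: distance `45 * α` suffices.
-/

/-! ### Stability of additivity, global and local -/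

/-- **Hyers' theorem**: an approximately additive real function on a real vector space is close to
an additive one. -/
theorem exists_addMonoidHom_of_approx_additive {V : Type*} [AddCommGroup V] [Module ℝ V]
    (G : V → ℝ) (δ : ℝ) (hG : ∀ x y, |G (x + y) - G x - G y| ≤ δ) :
    ∃ h : V →+ ℝ, ∀ x, |G x - h x| ≤ δ := by
  -- Doubling: successive terms differ by at most `δ / 2 ^ (k + 1)`, which sums to `δ`; the
  -- additivity defect of `u · k` is at most `δ / 2 ^ k`, so the limit is additive.
  let u : V → ℕ → ℝ := fun x k => G ((2 : ℝ) ^ k • x) / 2 ^ k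
  have hu : ∀ x k, dist (u x k) (u x (k + 1)) ≤ δ / 2 / 2 ^ k := by
    intro x k
    have h1 := hG ((2 : ℝ) ^ k • x) ((2 : ℝ) ^ k • x)
    have h2 : (2 : ℝ) ^ k • x + (2 : ℝ) ^ k • x = (2 : ℝ) ^ (k + 1) • x := by
      rw [← add_smul]; congr 1; ring
    have h3 : u x k - u x (k + 1) =
        -(G ((2 : ℝ) ^ k • x + (2 : ℝ) ^ k • x) - G ((2 : ℝ) ^ k • x) - G ((2 : ℝ) ^ k • x))
          / 2 / 2 ^ k := by
      simp only [u, h2]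
      field_simp
      ring
    rw [Real.dist_eq, h3, abs_div, abs_div, abs_neg, abs_of_pos (by positivity : (0 : ℝ) < 2 ^ k),
      abs_two]
    gcongr
  have hlim : ∀ x, ∃ l, Filter.Tendsto (u x) Filter.atTop (nhds l) := fun x =>
    cauchySeq_tendsto_of_complete (cauchySeq_of_le_geometric_two (hu x))
  choose h hh using hlim
  have hadd : ∀ x y, h (x + y) = h x + h y := by
    intro x y
    have h1 : Filter.Tendsto (fun k => u (x + y) k - u x k - u y k) Filter.atTop
        (nhds (h (x + y) - h x - h y)) := ((hh _).sub (hh _)).sub (hh _)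
    have h2 : Filter.Tendsto (fun k => u (x + y) k - u x k - u y k) Filter.atTop (nhds 0) := by
      refine squeeze_zero_norm (a := fun k : ℕ => δ * (1 / 2) ^ k) (fun k => ?_) ?_
      · have h3 := hG ((2 : ℝ) ^ k • x) ((2 : ℝ) ^ k • y)
        have h4 : u (x + y) k - u x k - u y k = (G ((2 : ℝ) ^ k • x + (2 : ℝ) ^ k • y)
            - G ((2 : ℝ) ^ k • x) - G ((2 : ℝ) ^ k • y)) / 2 ^ k := by
          simp only [u, smul_add]; ring
        rw [h4, Real.norm_eq_abs, abs_div, abs_of_pos (by positivity : (0 : ℝ) < 2 ^ k),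
          one_div, inv_pow, ← div_eq_mul_inv]
        gcongr
      · simpa using (tendsto_pow_atTop_nhds_zero_of_lt_one (by norm_num : (0 : ℝ) ≤ 1 / 2)
          (by norm_num)).const_mul δ
    linarith [tendsto_nhds_unique h1 h2]
  refine ⟨AddMonoidHom.mk' h hadd, fun x => ?_⟩
  have h1 := dist_le_of_le_geometric_two_of_tendsto₀ (hu x) (hh x)
  simpa [u, Real.dist_eq] using h1

theorem EuclideanSpace.norm_le_card_mul {n : ℕ} (x : EuclideanSpace ℝ (Fin n)) (a : ℝ)
    (hx : ∀ i, |x i| ≤ a) : ‖x‖ ≤ n * a := by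
  have h : x = ∑ i, EuclideanSpace.single i (x i) := by
    ext j
    simp [Finset.sum_apply, Pi.single_apply]
  rw [h]
  refine (norm_sum_le _ _).trans ((Finset.sum_le_sum fun i _ => ?_).trans_eq
    (by simp : ∑ _i : Fin n, a = n * a))
  simpa using hx i

theorem norm_sum_single_le {n : ℕ} (S : Finset (Fin n)) (c : Fin n → ℝ) (s : ℝ)
    (hc : ∀ i, |c i| ≤ s) (hs : 0 ≤ s) : ‖∑ i ∈ S, EuclideanSpace.single i (c i)‖ ≤ n * s := by
  refine (norm_sum_le _ _).trans ((Finset.sum_le_sum (g := fun _ => s) fun i _ => ?_).trans ?_)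
  · simpa using hc i
  · rw [Finset.sum_const, nsmul_eq_mul]
    gcongr
    simpa using Finset.card_le_univ S

/-- Subtracting a combination of the vectors `s eᵢ` with coefficients in `{-1, 0, 1}` from `w`
changes a locally approximately additive function as an additive function would, up to one error
term per coordinate. -/
theorem abs_sub_sum_single_le {n : ℕ} {g : EuclideanSpace ℝ (Fin n) → ℝ} {δ s ρ : ℝ}
    (hs : 0 < s) (hρ : 2 * (n + 1) * s ≤ ρ) (hδ : 0 ≤ δ)
    (hg : ∀ p q, ‖p‖ ≤ ρ → ‖q‖ ≤ ρ → ‖p + q‖ ≤ ρ → |g (p + q) - g p - g q| ≤ δ)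
    (c : Fin n → ℤ) (hc : ∀ i, c i = -1 ∨ c i = 0 ∨ c i = 1) (w : EuclideanSpace ℝ (Fin n))
    (hw : ‖w‖ ≤ n * s) (S : Finset (Fin n)) :
    |g (w - ∑ i ∈ S, EuclideanSpace.single i (s * c i)) - g w +
      ∑ i ∈ S, c i * g (EuclideanSpace.single i s)| ≤ S.card * δ := by
  have hn : (0 : ℝ) ≤ n := n.cast_nonneg
  have hcs : ∀ i, |s * (c i : ℝ)| ≤ s := by
    intro i
    rcases hc i with h | h | h <;> simp [h, abs_of_pos hs, hs.le]
  have hbound : ∀ T : Finset (Fin n),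
      ‖w - ∑ i ∈ T, EuclideanSpace.single i (s * (c i : ℝ))‖ ≤ ρ := by
    intro T
    refine (norm_sub_le _ _).trans ?_
    have := norm_sum_single_le T _ s hcs hs.le
    nlinarith
  induction S using Finset.induction_on with
  | empty => simp
  | insert i S hi ih =>
    have h1 := hbound S
    have h2 := hbound (insert i S)
    rw [Finset.sum_insert hi] at h2
    rw [Finset.sum_insert hi, Finset.sum_insert hi, Finset.card_insert_of_notMem hi]
    have h3 : ‖(EuclideanSpace.single i s : EuclideanSpace ℝ (Fin n))‖ ≤ ρ := by
      rw [PiLp.norm_single, Real.norm_eq_abs, abs_of_pos hs]; nlinarith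
    set v := ∑ i ∈ S, EuclideanSpace.single i (s * (c i : ℝ))
    have step : |g (w - (EuclideanSpace.single i (s * (c i : ℝ)) + v)) - g (w - v)
        + c i * g (EuclideanSpace.single i s)| ≤ δ := by
      rcases hc i with h | h | h
      · have e : w - (EuclideanSpace.single i (s * (c i : ℝ)) + v)
            = (w - v) + EuclideanSpace.single i s := by
          have : (EuclideanSpace.single i (s * (c i : ℝ)) : EuclideanSpace ℝ (Fin n))
              = - EuclideanSpace.single i s := by
            ext j; by_cases hj : j = i <;> simp [h, hj]
          rw [this]; abel
        rw [e] at h2 ⊢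
        have := hg _ _ h1 h3 h2
        rw [h]; push_cast
        convert this using 2; ring
      · have : (EuclideanSpace.single i (s * (c i : ℝ)) : EuclideanSpace ℝ (Fin n)) = 0 := by
          ext j; simp [h]
        rw [this, zero_add, h]
        simpa using hδ
      -- Reading the approximate identity backwards avoids any value of `g` at a negative multiple
      -- of the basis vector.
      · have e : w - v = (w - (EuclideanSpace.single i (s * (c i : ℝ)) + v))
            + EuclideanSpace.single i s := by
          have : (EuclideanSpace.single i (s * (c i : ℝ)) : EuclideanSpace ℝ (Fin n))
              = EuclideanSpace.single i s := by
            simp [h]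
          rw [this]; abel
        have := hg _ _ h2 h3 (by rw [← e]; exact h1)
        rw [← e] at this
        rw [h, Int.cast_one, one_mul]
        rw [h, Int.cast_one] at this
        rw [abs_le] at this ⊢
        constructor <;> linarith [this.1, this.2]
    push_cast
    rw [abs_le] at ih step ⊢
    constructor <;> linarith [ih.1, ih.2, step.1, step.2]

/-- Local stability of additivity on Euclidean balls, with a constant independent of the
dimension: a function that is approximately additive on a sufficiently larger ball is close to an
additive function on the ball of radius `R`. -/
theorem exists_addMonoidHom_of_locally_approx_additive (n : ℕ) (R : ℝ) (hR : 0 < R) :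
    ∃ ρ : ℝ, R ≤ ρ ∧ ∀ (g : EuclideanSpace ℝ (Fin n) → ℝ) (δ : ℝ), 0 ≤ δ →
      (∀ p q, ‖p‖ ≤ ρ → ‖q‖ ≤ ρ → ‖p + q‖ ≤ ρ → |g (p + q) - g p - g q| ≤ δ) →
      ∃ h : EuclideanSpace ℝ (Fin n) →+ ℝ, ∀ x, ‖x‖ ≤ R → |g x - h x| ≤ 2 * δ := by
  have hn : (0 : ℝ) ≤ n := n.cast_nonneg
  -- With this mesh, points of norm at most `(n + 1) * R` have coordinates at most `s / 4` and round
  -- to `0`.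
  obtain ⟨s, hs⟩ : ∃ s : ℝ, s = 4 * (n + 1) * R := ⟨_, rfl⟩
  have hs0 : 0 < s := by rw [hs]; positivity
  have hsR : (n + 1) * R ≤ 2 * (n + 1) * s := by rw [hs]; nlinarith [mul_nonneg hn hR.le]
  refine ⟨2 * (n + 1) * s, by nlinarith, fun g δ hδ hg => ?_⟩
  let k : EuclideanSpace ℝ (Fin n) → Fin n → ℤ := fun x i => round (x i / s)
  let t : EuclideanSpace ℝ (Fin n) → EuclideanSpace ℝ (Fin n) := fun x =>
    x - ∑ i, EuclideanSpace.single i (s * (k x i : ℝ))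
  have ht_apply : ∀ x i, t x i = x i - s * k x i := by
    intro x i
    simp [t, Finset.sum_apply, Pi.single_apply]
  have ht : ∀ x i, |t x i| ≤ s / 2 := by
    intro x i
    have h1 := abs_sub_round (x i / s)
    have h2 : t x i = s * (x i / s - k x i) := by
      rw [ht_apply]; field_simp
    rw [h2, abs_mul, abs_of_pos hs0]
    calc s * |x i / s - k x i| ≤ s * (1 / 2) := by gcongr
      _ = s / 2 := by ring
  have htn : ∀ x, ‖t x‖ ≤ n * (s / 2) := fun x => EuclideanSpace.norm_le_card_mul _ _ (ht x)
  -- A global extension of `g` from near the origin: additive on the lattice of mesh `s`, and `g` on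
  -- the remainder `t x`.
  let G : EuclideanSpace ℝ (Fin n) → ℝ := fun x =>
    ∑ i, k x i * g (EuclideanSpace.single i s) + g (t x)
  have hG : ∀ x y, |G (x + y) - G x - G y| ≤ (n + 1) * δ := by
    intro x y
    -- The carries: `s * c i` combines three remainders of size at most `s / 2`, so `|c i| ≤ 3 / 2`.
    -- They cost at most `n * δ`, and adding `t x` and `t y` one more `δ`.
    let c : Fin n → ℤ := fun i => k (x + y) i - k x i - k y i
    have htc : ∀ i, t (x + y) i = t x i + t y i - s * c i := by
      intro i
      simp only [ht_apply, c, PiLp.add_apply]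
      push_cast; ring
    have hc : ∀ i, c i = -1 ∨ c i = 0 ∨ c i = 1 := by
      intro i
      have h1 := abs_le.1 (ht x i)
      have h2 := abs_le.1 (ht y i)
      have h3 := abs_le.1 (ht (x + y) i)
      rw [htc] at h3
      have h4 : (c i : ℝ) < 2 := by nlinarith
      have h5 : (-2 : ℝ) < c i := by nlinarith
      have h4' : c i < 2 := by exact_mod_cast h4
      have h5' : -2 < c i := by exact_mod_cast h5
      omega
    have hw : ‖t x + t y‖ ≤ n * s := by
      refine (norm_add_le _ _).trans ?_
      linarith [htn x, htn y]
    have h1 := abs_sub_sum_single_le hs0 le_rfl hδ hg c hc (t x + t y) hw Finset.univ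
    have h2 : t x + t y - ∑ i, EuclideanSpace.single i (s * (c i : ℝ)) = t (x + y) := by
      ext i
      rw [htc]
      simp [Finset.sum_apply, Pi.single_apply]
    rw [h2, Finset.card_univ, Fintype.card_fin] at h1
    have h3 := hg (t x) (t y) (by nlinarith [htn x]) (by nlinarith [htn y]) (by nlinarith)
    have h4 : ∑ i, (c i : ℝ) * g (EuclideanSpace.single i s) =
        ∑ i, k (x + y) i * g (EuclideanSpace.single i s)
        - ∑ i, k x i * g (EuclideanSpace.single i s)
        - ∑ i, k y i * g (EuclideanSpace.single i s) := by
      simp only [c, ← Finset.sum_sub_distrib]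
      exact Finset.sum_congr rfl fun i _ => by push_cast; ring
    rw [h4] at h1
    simp only [G]
    rw [abs_le] at h1 h3 ⊢
    constructor <;> linarith [h1.1, h1.2, h3.1, h3.2]
  obtain ⟨h, hh⟩ := exists_addMonoidHom_of_approx_additive G _ hG
  have hGg : ∀ x, ‖x‖ ≤ (n + 1) * R → G x = g x := by
    intro x hx
    have hk : ∀ i, k x i = 0 := by
      intro i
      have h1 : |x i| ≤ (n + 1) * R := (PiLp.norm_apply_le x i).trans hx
      rw [abs_le] at h1
      have h2 : (n + 1) * R = s / 4 := by rw [hs]; ring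
      rw [h2] at h1
      rw [round_eq_zero_iff]
      constructor
      · rw [le_div_iff₀ hs0]; linarith
      · rw [div_lt_iff₀ hs0]; linarith
    have ht0 : t x = x := by ext i; simp [ht_apply, hk]
    simp [G, hk, ht0]
  refine ⟨h, fun x hx => ?_⟩
  -- Hyers' theorem loses a factor `n + 1`. Comparing `g` and `h` at `(n + 1) • x` and dividing by
  -- `n + 1` removes it: the total there is `n * δ + (n + 1) * δ`.
  have hmul : ∀ N : ℕ, N ≤ n → |g (((N + 1 : ℕ) : ℝ) • x) - (N + 1 : ℕ) * g x| ≤ N * δ := by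
    intro N
    induction N with
    | zero => simp
    | succ N ih =>
      intro hN
      have h1 := ih (by omega)
      have hb : ∀ M : ℕ, M ≤ n + 1 → ‖(M : ℝ) • x‖ ≤ 2 * (n + 1) * s := by
        intro M hM
        rw [norm_smul, Real.norm_natCast]
        refine le_trans ?_ hsR
        have : (M : ℝ) ≤ n + 1 := by exact_mod_cast hM
        gcongr
      have e : ((N + 1 + 1 : ℕ) : ℝ) • x = ((N + 1 : ℕ) : ℝ) • x + x := by
        push_cast; rw [add_smul _ (1 : ℝ), one_smul]
      have h2 := hg (((N + 1 : ℕ) : ℝ) • x) x (hb _ (by omega))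
        (by simpa using hb 1 (by omega)) (by rw [← e]; exact hb _ (by omega))
      rw [← e] at h2
      push_cast at h1 h2 ⊢
      rw [abs_le] at h1 h2 ⊢
      constructor <;> linarith [h1.1, h1.2, h2.1, h2.2]
  have h1 := hmul n le_rfl
  have h2 := hh (((n + 1 : ℕ) : ℝ) • x)
  have h3 : ‖((n + 1 : ℕ) : ℝ) • x‖ ≤ (n + 1) * R := by
    rw [norm_smul, Real.norm_natCast]; push_cast; gcongr
  have h4 : h (((n + 1 : ℕ) : ℝ) • x) = (n + 1 : ℕ) * h x := by
    rw [Nat.cast_smul_eq_nsmul, map_nsmul, nsmul_eq_mul]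
  rw [hGg _ h3, h4] at h2
  have h5 : (n + 1) * |g x - h x| ≤ (n + 1) * (2 * δ) := by
    rw [← abs_of_pos (by positivity : (0 : ℝ) < n + 1), ← abs_mul]
    rw [abs_of_pos (by positivity : (0 : ℝ) < n + 1)]
    push_cast at h1 h2
    rw [abs_le] at h1 h2 ⊢
    constructor <;> nlinarith [h1.1, h1.2, h2.1, h2.2]
  exact le_of_mul_le_mul_left h5 (by positivity)

/-! ### Almost translation-invariant distributions -/

/-- For every radius `ρ` there is a probability distribution on `ℝⁿ` that is almost invariant under
all translations by vectors of norm at most `ρ`: the uniform distribution on a large ball. -/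
theorem exists_almost_translation_invariant (n : ℕ) (ρ η : ℝ) (hρ : 0 < ρ) (hη : 0 < η) :
    ∃ μ : Measure (EuclideanSpace ℝ (Fin n)), IsProbabilityMeasure μ ∧
      ∀ p, ‖p‖ ≤ ρ → ∀ A, MeasurableSet A → μ.real ((fun x => p + x) ⁻¹' A) ≤ μ.real A + η := by
  obtain ⟨r, hr0, hr⟩ : ∃ r : ℝ, 0 < r ∧ ((r + ρ) / r) ^ n < 1 + η := by
    have h1 : Filter.Tendsto (fun r : ℝ => (1 + ρ / r) ^ n) Filter.atTop (nhds ((1 + 0) ^ n)) :=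
      ((tendsto_const_nhds.div_atTop Filter.tendsto_id).const_add 1).pow n
    have h2 := h1.eventually (gt_mem_nhds (by simpa using hη : (1 + 0 : ℝ) ^ n < 1 + η))
    obtain ⟨r, h3, h4⟩ := (h2.and (Filter.eventually_gt_atTop 0)).exists
    refine ⟨r, h4, ?_⟩
    rwa [add_div, div_self h4.ne']
  let B := Metric.ball (0 : EuclideanSpace ℝ (Fin n)) r
  let v : ℝ := volume.real B
  have hB0 : volume B ≠ 0 := (Metric.measure_ball_pos _ _ hr0).ne'
  have hBt : volume B ≠ ⊤ := measure_ball_lt_top.ne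
  have hv : 0 < v := ENNReal.toReal_pos hB0 hBt
  have hcond : ∀ A, (ProbabilityTheory.cond volume B).real A = volume.real (B ∩ A) / v := by
    intro A
    rw [measureReal_def, ProbabilityTheory.cond_apply measurableSet_ball, ENNReal.toReal_mul,
      ENNReal.toReal_inv, div_eq_inv_mul]
    rfl
  have hfin : ∀ (q : EuclideanSpace ℝ (Fin n)) (s : ℝ) (A : Set _),
      volume (Metric.ball q s ∩ A) ≠ ⊤ := fun q s A =>
    measure_ne_top_of_subset Set.inter_subset_left measure_ball_lt_top.ne
  refine ⟨ProbabilityTheory.cond volume B,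
    ProbabilityTheory.cond_isProbabilityMeasure_of_finite hB0 hBt, fun p hp A hA => ?_⟩
  have hshift : volume.real (B ∩ (fun x => p + x) ⁻¹' A) = volume.real (Metric.ball p r ∩ A) := by
    have : B ∩ (fun x => p + x) ⁻¹' A = (fun x => p + x) ⁻¹' (Metric.ball p r ∩ A) := by
      rw [Set.preimage_inter, preimage_add_ball, sub_self]
    rw [this, measureReal_def, measure_preimage_add, measureReal_def]
  -- Translation gains at most a shell of thickness `ρ`, of relative volume below `η` by the choice
  -- of `r`.
  have hsub : Metric.ball p r ∩ A ⊆ B ∩ A ∪ Metric.ball 0 (r + ρ) \ B := by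
    rintro x ⟨hx, hxA⟩
    by_cases hxB : x ∈ B
    · exact Or.inl ⟨hxB, hxA⟩
    · refine Or.inr ⟨?_, hxB⟩
      rw [Metric.mem_ball, dist_eq_norm] at hx ⊢
      have := norm_add_le (x - p) p
      rw [sub_add_cancel] at this
      rw [sub_zero]; linarith
  have hbig : volume.real (Metric.ball (0 : EuclideanSpace ℝ (Fin n)) (r + ρ))
      = ((r + ρ) / r) ^ n * v := by
    have := Measure.addHaar_ball_mul_of_pos (volume : Measure (EuclideanSpace ℝ (Fin n))) 0
      (by positivity : 0 < (r + ρ) / r) r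
    rw [div_mul_cancel₀ _ hr0.ne', finrank_euclideanSpace_fin] at this
    rw [measureReal_def, this, ENNReal.toReal_mul, ENNReal.toReal_ofReal (by positivity)]
    rfl
  have hann : volume.real (Metric.ball (0 : EuclideanSpace ℝ (Fin n)) (r + ρ) \ B) ≤ η * v := by
    rw [measureReal_sdiff (Metric.ball_subset_ball (by linarith)) measurableSet_ball
      measure_ball_lt_top.ne, hbig]
    change _ - v ≤ _
    nlinarith
  rw [hcond, hcond, hshift, div_add' _ _ _ hv.ne']
  gcongr
  refine (measureReal_mono hsub ?_).trans ((measureReal_union_le _ _).trans (by gcongr))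
  exact measure_union_ne_top (hfin _ _ _) (hfin _ _ _)

theorem measureReal_prod_eq_integral {X Y : Type*} [MeasurableSpace X] [MeasurableSpace Y]
    (μ : Measure X) (ν : Measure Y) [IsFiniteMeasure μ] [IsFiniteMeasure ν] {S : Set (X × Y)}
    (hS : MeasurableSet S) : (μ.prod ν).real S = ∫ x, ν.real (Prod.mk x ⁻¹' S) ∂μ := by
  rw [measureReal_def, Measure.prod_apply hS]
  exact (integral_toReal (measurable_measure_prodMk_left hS).aemeasurable
    (.of_forall fun x => measure_lt_top _ _)).symm

/-! ### Self-correction -/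

section SelfCorrection

variable {V : Type*} [AddCommGroup V] [MeasurableSpace V] [MeasurableAdd₂ V]

/-- If a random pair violates approximate additivity of `f` with small probability, then the
differences `f (p + x) - f x` are concentrated. -/
theorem exists_concentrated_difference (μ : Measure V) [IsProbabilityMeasure μ] {f : V → ℝ}
    (hf : Measurable f) {α : ℝ} {p : V}
    (hμ : ∀ A, MeasurableSet A → μ.real ((fun x => p + x) ⁻¹' A) ≤ μ.real A + 1 / 16)
    (hE : (μ.prod μ).real {z | 3 * α < |f z.1 + f z.2 - f (z.1 + z.2)|} ≤ 1 / 16) :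
    ∃ c : ℝ, μ.real {x | 6 * α < |f (p + x) - f x - c|} ≤ 1 / 4 := by
  set S : Set (V × V) := {z | 3 * α < |f z.1 + f z.2 - f (z.1 + z.2)|} with hS_def
  have hS : MeasurableSet S := measurableSet_lt measurable_const (by fun_prop)
  let S' : Set (V × V) := (fun z => (p + z.1, z.2)) ⁻¹' S
  have hS' : MeasurableSet S' := by
    have : Measurable fun z : V × V => (p + z.1, z.2) := by fun_prop
    exact this hS
  let b : V → ℝ := fun y => μ.real (Prod.mk y ⁻¹' S)
  let b' : V → ℝ := fun y => μ.real (Prod.mk y ⁻¹' S')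
  have hb : Integrable b μ := Measure.integrable_measure_prodMk_left hS (measure_ne_top _ _)
  have hb' : Integrable b' μ := Measure.integrable_measure_prodMk_left hS' (measure_ne_top _ _)
  have hib : ∫ y, b y ∂μ ≤ 1 / 16 := by rwa [measureReal_prod_eq_integral μ μ hS] at hE
  have hib' : ∫ y, b' y ∂μ ≤ 1 / 16 + 1 / 16 := by
    rw [← measureReal_prod_eq_integral μ μ hS']
    -- Swapping makes the translated coordinate the inner variable, where almost invariance applies
    -- slice by slice.
    have hsw : (μ.prod μ).real S' = (μ.prod μ).real (Prod.swap ⁻¹' S') := by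
      rw [measureReal_def, measureReal_def,
        (Measure.measurePreserving_swap (μ := μ) (ν := μ)).measure_preimage hS'.nullMeasurableSet]
    have hsw' : (μ.prod μ).real S = (μ.prod μ).real (Prod.swap ⁻¹' S) := by
      rw [measureReal_def, measureReal_def,
        (Measure.measurePreserving_swap (μ := μ) (ν := μ)).measure_preimage hS.nullMeasurableSet]
    have hSs := measurable_swap hS
    have hS's := measurable_swap hS'
    rw [hsw, measureReal_prod_eq_integral μ μ hS's]
    rw [hsw', measureReal_prod_eq_integral μ μ hSs] at hE
    have hi := Measure.integrable_measure_prodMk_left (μ := μ) (ν := μ) hSs (measure_ne_top _ _)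
    calc ∫ y, μ.real (Prod.mk y ⁻¹' (Prod.swap ⁻¹' S')) ∂μ
        ≤ ∫ y, (μ.real (Prod.mk y ⁻¹' (Prod.swap ⁻¹' S)) + 1 / 16) ∂μ := by
          refine integral_mono (Measure.integrable_measure_prodMk_left hS's (measure_ne_top _ _))
            (hi.add (integrable_const _)) fun y => ?_
          exact hμ _ (measurable_prodMk_left hSs)
      _ = ∫ y, μ.real (Prod.mk y ⁻¹' (Prod.swap ⁻¹' S)) ∂μ + 1 / 16 := by
          rw [integral_add hi (integrable_const _)]; simp
      _ ≤ _ := by gcongr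
  -- Fix a `y` that is no worse than average, so `b y + b' y ≤ 3 / 16`; one more translation brings
  -- this to `1 / 4`. For good `x`, both `f y + f (p + x)` and `f (p + y) + f x` are within `3 * α`
  -- of `f (p + x + y)`.
  obtain ⟨y, hy⟩ := exists_le_integral (hb.add hb')
  rw [integral_add' hb hb', Pi.add_apply] at hy
  refine ⟨f (p + y) - f y, ?_⟩
  have hsub : {x | 6 * α < |f (p + x) - f x - (f (p + y) - f y)|} ⊆
      (fun x => p + x) ⁻¹' (Prod.mk y ⁻¹' S) ∪ Prod.mk y ⁻¹' S' := by
    intro x hx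
    by_contra hcon
    simp only [Set.mem_union, not_or] at hcon
    obtain ⟨h1, h2⟩ := hcon
    have h1' : |f y + f (p + x) - f (y + (p + x))| ≤ 3 * α := not_lt.1 h1
    have h2' : |f (p + y) + f x - f (p + y + x)| ≤ 3 * α := not_lt.1 h2
    have e : p + y + x = y + (p + x) := by abel
    rw [e] at h2'
    refine absurd (Set.mem_ofPred.1 hx) (not_lt.2 ?_)
    rw [abs_le] at h1' h2' ⊢
    constructor <;> linarith [h1'.1, h1'.2, h2'.1, h2'.2]
  have h1 := hμ _ (measurable_prodMk_left (x := y) hS)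
  have h2 : μ.real ((fun x => p + x) ⁻¹' (Prod.mk y ⁻¹' S)) ≤ b y + 1 / 16 := h1
  refine (measureReal_mono hsub).trans ((measureReal_union_le _ _).trans ?_)
  change _ + b' y ≤ _
  linarith

/-- The centers of concentration of the differences `f (p + x) - f x` are approximately additive
in `p`. -/
theorem abs_concentrated_difference_le (μ : Measure V) [IsProbabilityMeasure μ] {f : V → ℝ}
    (hf : Measurable f) {α : ℝ} {p q : V} {a b c : ℝ}
    (hμ : ∀ A, MeasurableSet A → μ.real ((fun x => q + x) ⁻¹' A) ≤ μ.real A + 1 / 16)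
    (ha : μ.real {x | 6 * α < |f (p + x) - f x - a|} ≤ 1 / 4)
    (hb : μ.real {x | 6 * α < |f (q + x) - f x - b|} ≤ 1 / 4)
    (hc : μ.real {x | 6 * α < |f (p + q + x) - f x - c|} ≤ 1 / 4) :
    |c - a - b| ≤ 18 * α := by
  have hA : MeasurableSet {x | 6 * α < |f (p + x) - f x - a|} :=
    measurableSet_lt measurable_const (by fun_prop)
  have h1 := hμ _ hA
  -- The bad sets have total mass at most `(1/4 + 1/16) + 1/4 + 1/4 < 1`. At a good `x`, the
  -- difference over `p + q` telescopes through `q + x`, with three errors of `6 * α`.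
  obtain ⟨x, hx⟩ : ∃ x, x ∉ (fun x => q + x) ⁻¹' {x | 6 * α < |f (p + x) - f x - a|} ∪
      {x | 6 * α < |f (q + x) - f x - b|} ∪ {x | 6 * α < |f (p + q + x) - f x - c|} := by
    by_contra! hcon
    have h2 := congrArg μ.real (Set.eq_univ_of_forall hcon)
    have h3 := measureReal_union_le (μ := μ)
      ((fun x => q + x) ⁻¹' {x | 6 * α < |f (p + x) - f x - a|} ∪
      {x | 6 * α < |f (q + x) - f x - b|}) {x | 6 * α < |f (p + q + x) - f x - c|}
    have h4 := measureReal_union_le (μ := μ)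
      ((fun x => q + x) ⁻¹' {x | 6 * α < |f (p + x) - f x - a|})
      {x | 6 * α < |f (q + x) - f x - b|}
    rw [probReal_univ] at h2
    linarith
  simp only [Set.mem_union, not_or, Set.mem_preimage, Set.mem_ofPred_eq, not_lt] at hx
  obtain ⟨⟨h2, h3⟩, h4⟩ := hx
  rw [← add_assoc] at h2
  rw [abs_le] at h2 h3 h4 ⊢
  constructor <;> linarith [h2.1, h2.2, h3.1, h3.2, h4.1, h4.2]

/-- The triples `((x, y), p)` on which `f` visibly violates approximate additivity, either at
`(x, y)` or at `(p, x)`. -/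
def violationSet (f : V → ℝ) (α : ℝ) : Set ((V × V) × V) :=
  {z | 3 * α < |f z.1.1 + f z.1.2 - f (z.1.1 + z.1.2)|} ∪
    {z | 3 * α < |f (z.2 + z.1.1) - f z.1.1 - f z.2|}

theorem measurableSet_violationSet {f : V → ℝ} (hf : Measurable f) (α : ℝ) :
    MeasurableSet (violationSet f α) :=
  (measurableSet_lt measurable_const (by fun_prop)).union
    (measurableSet_lt measurable_const (by fun_prop))

end SelfCorrection

/-! ### Detection probability of one round -/

/-- For a suitable distribution of `x` and `y`, one round of the test finds a violation with
probability proportional to `ε`, if `f` is far from additive. -/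
theorem exists_law_violationSet_ge (n : ℕ) (R : ℝ) (hR : 0 < R) :
    ∃ μ : Measure (EuclideanSpace ℝ (Fin n)), IsProbabilityMeasure μ ∧
      ∀ (f : EuclideanSpace ℝ (Fin n) → ℝ) (α ε : ℝ) (D : Measure (EuclideanSpace ℝ (Fin n)))
        [IsProbabilityMeasure D], Measurable f → 0 < α → 0 < ε → ε < 1 →
        IsConcentrated D (ε / 4) R → IsFarFromAdditive f D (45 * α) ε →
        ε / 16 ≤ ((μ.prod μ).prod D).real (violationSet f α) := by
  obtain ⟨ρ, hRρ, hstab⟩ := exists_addMonoidHom_of_locally_approx_additive n R hR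
  obtain ⟨μ, hμ, hinv⟩ := exists_almost_translation_invariant n ρ (1 / 16) (by linarith)
    (by norm_num)
  refine ⟨μ, hμ, fun f α ε D _ hf hα hε hε1 hD hfar => ?_⟩
  let E := EuclideanSpace ℝ (Fin n)
  let S : Set (E × E) := {z | 3 * α < |f z.1 + f z.2 - f (z.1 + z.2)|}
  by_cases hE : (μ.prod μ).real S ≤ 1 / 16
  swap
  · have hsub : S ×ˢ (Set.univ : Set E) ⊆ violationSet f α := fun z hz => Or.inl hz.1
    have h1 := measureReal_mono (μ := (μ.prod μ).prod D) hsub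
    rw [measureReal_prod_prod, probReal_univ, mul_one] at h1
    linarith
  have hdiff : ∀ p : E, ‖p‖ ≤ ρ → ∃ c : ℝ, μ.real {x | 6 * α < |f (p + x) - f x - c|} ≤ 1 / 4 :=
    fun p hp => exists_concentrated_difference μ hf (hinv p hp) hE
  choose! g hg using hdiff
  obtain ⟨h, hh⟩ := hstab g (18 * α) (by positivity) fun p q hp hq hpq =>
    abs_concentrated_difference_le μ hf (hinv q hq) (hg p hp) (hg q hq) (hg _ hpq)
  let T : Set (E × (E × E)) := Prod.swap ⁻¹' violationSet f α
  have hT : MeasurableSet T := measurable_swap (measurableSet_violationSet hf α)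
  let φ : E → ℝ := fun p => (μ.prod μ).real (Prod.mk p ⁻¹' T)
  -- The constant is `45 = 36 + 6 + 3`: stability, concentration and the tolerance of the check.
  have hφ : ∀ p, ‖p‖ ≤ R → 45 * α < |f p - h p| → 3 / 4 ≤ φ p := by
    intro p hp hfp
    let A : Set E := {x | 6 * α < |f (p + x) - f x - g p|}
    have hA : MeasurableSet A := measurableSet_lt measurable_const (by fun_prop)
    have hsub : Aᶜ ×ˢ (Set.univ : Set E) ⊆ Prod.mk p ⁻¹' T := by
      rintro ⟨x, y⟩ ⟨hx, -⟩
      refine Or.inr ?_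
      have h1 : |f (p + x) - f x - g p| ≤ 6 * α := not_lt.1 hx
      have h2 := hh p hp
      change 3 * α < |f (p + x) - f x - f p|
      by_contra! h3
      refine absurd hfp (not_lt.2 ?_)
      rw [abs_le] at h1 h2 h3 ⊢
      constructor <;> linarith [h1.1, h1.2, h2.1, h2.2, h3.1, h3.2]
    have h1 := measureReal_mono (μ := μ.prod μ) hsub
    rw [measureReal_prod_prod, probReal_univ, mul_one, probReal_compl_eq_one_sub hA] at h1
    have h2 : μ.real A ≤ 1 / 4 := hg p (hp.trans hRρ)
    change _ ≤ φ p at h1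
    linarith
  have hQ : 3 / 4 * ε ≤ D.real {p | 3 / 4 ≤ φ p} := by
    have hsub : {p | 45 * α < |f p - h p|} ⊆ {p | 3 / 4 ≤ φ p} ∪ (Metric.ball 0 R)ᶜ := by
      intro p hp
      by_cases hpR : p ∈ Metric.ball (0 : E) R
      · exact Or.inl (hφ p (by simpa using (mem_ball_zero_iff.1 hpR).le) hp)
      · exact Or.inr hpR
    have h1 := (measureReal_mono (μ := D) hsub).trans (measureReal_union_le _ _)
    rw [probReal_compl_eq_one_sub measurableSet_ball] at h1
    have h2 := hfar h
    unfold IsConcentrated at hD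
    linarith
  -- Markov gives `9 / 16 * ε`; the weaker `ε / 16` comes from the case where the check at `(x, y)`
  -- already fails often.
  have hmarkov := mul_meas_ge_le_integral_of_nonneg (μ := D) (f := φ)
    (.of_forall fun _ => measureReal_nonneg)
    (Measure.integrable_measure_prodMk_left hT (measure_ne_top _ _)) (3 / 4)
  have hint : ((μ.prod μ).prod D).real (violationSet f α) = ∫ p, φ p ∂D := by
    rw [← measureReal_prod_eq_integral D (μ.prod μ) hT, measureReal_def, measureReal_def,
      (Measure.measurePreserving_swap (μ := D) (ν := μ.prod μ)).measure_preimage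
        (measurableSet_violationSet hf α).nullMeasurableSet]
  rw [hint]
  linarith

/-! ### The tester and its acceptance probabilities -/

namespace Tester

variable {n : ℕ}

theorem answers_apply (T : Tester n) (f : EuclideanSpace ℝ (Fin n) → ℝ)
    (z : T.Coins × (Fin T.numSamples → EuclideanSpace ℝ (Fin n))) (k : ℕ) (i : Fin k) :
    T.answers f z k i = f (T.query i (z.1, z.2, T.answers f z i)) := by
  induction k with
  | zero => exact i.elim0
  | succ k ih =>
    rw [answers]
    refine Fin.lastCases ?_ (fun j => ?_) i
    · simp
    · simpa using ih j

end Tester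

/-- The points queried in one round, for `x, y` from the coins and a sample `p`. -/
def roundPoint {V : Type*} [Add V] : Fin 5 → (V × V) × V → V :=
  ![fun z => z.1.1, fun z => z.1.2, fun z => z.1.1 + z.1.2, fun z => z.2, fun z => z.2 + z.1.1]

theorem measurable_roundPoint {V : Type*} [Add V] [MeasurableSpace V] [MeasurableAdd₂ V]
    (j : Fin 5) : Measurable (roundPoint (V := V) j) := by
  fin_cases j <;> simp only [roundPoint] <;> dsimp <;> fun_prop

theorem notMem_violationSet_iff {V : Type*} [AddCommGroup V] (f : V → ℝ) (α : ℝ)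
    (w : (V × V) × V) (a : Fin 5 → ℝ) (ha : ∀ j, a j = f (roundPoint j w)) :
    w ∉ violationSet f α ↔ |a 0 + a 1 - a 2| ≤ 3 * α ∧ |a 4 - a 0 - a 3| ≤ 3 * α := by
  simp only [violationSet, Set.mem_union, not_or, Set.mem_ofPred_eq, not_lt, ha]
  rfl

/-- The tester that in each of `m` rounds draws `x, y` from `μ` and a sample `p`, and rejects if
`f` violates approximate additivity at `(x, y)` or at `(p, x)`. -/
noncomputable def additivityTester {n : ℕ} (μ : Measure (EuclideanSpace ℝ (Fin n)))
    [IsProbabilityMeasure μ] (α : ℝ) (m : ℕ) : Tester n where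
  numSamples := m
  numQueries := m * 5
  Coins := Fin m → EuclideanSpace ℝ (Fin n) × EuclideanSpace ℝ (Fin n)
  coinsMeasurableSpace := inferInstance
  coinLaw := Measure.pi fun _ => μ.prod μ
  coinLaw_isProbabilityMeasure := inferInstance
  query k z := if h : k < m * 5 then
      roundPoint (finProdFinEquiv.symm ⟨k, h⟩).2
        (z.1 (finProdFinEquiv.symm ⟨k, h⟩).1, z.2.1 (finProdFinEquiv.symm ⟨k, h⟩).1)
    else 0
  measurable_query k := by
    by_cases h : k < m * 5
    · simp only [h, dite_true]
      exact (measurable_roundPoint _).comp (by fun_prop)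
    · simp only [h, dite_false]
      exact measurable_const
  acceptSet := {w | ∀ i : Fin m,
    |w.2.2 (finProdFinEquiv (i, 0)) + w.2.2 (finProdFinEquiv (i, 1))
      - w.2.2 (finProdFinEquiv (i, 2))| ≤ 3 * α ∧
    |w.2.2 (finProdFinEquiv (i, 4)) - w.2.2 (finProdFinEquiv (i, 0))
      - w.2.2 (finProdFinEquiv (i, 3))| ≤ 3 * α}
  measurableSet_acceptSet := by
    rw [Set.ofPred_forall]
    refine MeasurableSet.iInter fun i => ?_
    rw [Set.ofPred_and]
    refine (measurableSet_le ?_ measurable_const).inter (measurableSet_le ?_ measurable_const) <;>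
      fun_prop

section AdditivityTester

variable {n : ℕ} (μ : Measure (EuclideanSpace ℝ (Fin n))) [IsProbabilityMeasure μ]

theorem acceptEvent_additivityTester (α : ℝ) (m : ℕ) (f : EuclideanSpace ℝ (Fin n) → ℝ) :
    (additivityTester μ α m).acceptEvent f =
      {z : (Fin m → EuclideanSpace ℝ (Fin n) × EuclideanSpace ℝ (Fin n)) ×
        (Fin m → EuclideanSpace ℝ (Fin n)) | ∀ i, (z.1 i, z.2 i) ∉ violationSet f α} := by
  have key : ∀ (z : (Fin m → EuclideanSpace ℝ (Fin n) × EuclideanSpace ℝ (Fin n)) ×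
      (Fin m → EuclideanSpace ℝ (Fin n))) (i : Fin m) (j : Fin 5),
      (additivityTester μ α m).answers f z (m * 5) (finProdFinEquiv (i, j)) =
        f (roundPoint j (z.1 i, z.2 i)) := by
    intro z i j
    refine (Tester.answers_apply (additivityTester μ α m) f z _ _).trans (congrArg f ?_)
    have h : (finProdFinEquiv (i, j) : Fin (m * 5)).val < m * 5 := Fin.isLt _
    change (if h : _ then _ else _) = _
    rw [dif_pos h]
    simp only [Fin.eta, Equiv.symm_apply_apply]
  ext z
  exact forall_congr' fun i => (notMem_violationSet_iff f α _ _ (key z i)).symm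

theorem acceptProb_additivityTester_of_isCloseToAdditive {α : ℝ} (m : ℕ)
    {f : EuclideanSpace ℝ (Fin n) → ℝ} (D : Measure (EuclideanSpace ℝ (Fin n)))
    [IsProbabilityMeasure D] (hf : IsCloseToAdditive f α) :
    (additivityTester μ α m).acceptProb f D = 1 := by
  obtain ⟨h, hh⟩ := hf
  have huniv : (additivityTester μ α m).acceptEvent f = Set.univ := by
    rw [acceptEvent_additivityTester]
    refine Set.eq_univ_of_forall fun z i => ?_
    have add_close : ∀ x y, |f (x + y) - f x - f y| ≤ 3 * α := by
      intro x y
      have h1 := abs_le.1 (hh x)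
      have h2 := abs_le.1 (hh y)
      have h3 := abs_le.1 (hh (x + y))
      rw [map_add] at h3
      rw [abs_le]
      constructor <;> linarith [h1.1, h1.2, h2.1, h2.2, h3.1, h3.2]
    simp only [violationSet, Set.mem_union, not_or, Set.mem_ofPred_eq, not_lt]
    refine ⟨?_, ?_⟩
    · have := add_close (z.1 i).1 (z.1 i).2
      rwa [sub_sub, abs_sub_comm] at this
    · have := add_close (z.2 i) (z.1 i).1
      rwa [sub_right_comm] at this
  rw [Tester.acceptProb, huniv]
  unfold Tester.runLaw
  exact probReal_univ

/-- Regrouping the coins and the sample of each round turns the joint law into a product over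
independent rounds. -/
theorem rejectProb_additivityTester (α : ℝ) (m : ℕ) {f : EuclideanSpace ℝ (Fin n) → ℝ}
    (hf : Measurable f) (D : Measure (EuclideanSpace ℝ (Fin n))) [IsProbabilityMeasure D] :
    (additivityTester μ α m).rejectProb f D =
      1 - (1 - ((μ.prod μ).prod D).real (violationSet f α)) ^ m := by
  let E := EuclideanSpace ℝ (Fin n)
  set W := violationSet f α with hW_def
  have hW : MeasurableSet W := measurableSet_violationSet hf α
  let A : Set ((Fin m → E × E) × (Fin m → E)) := {z | ∀ i, (z.1 i, z.2 i) ∉ W}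
  have hA : MeasurableSet A := by
    change MeasurableSet {z : (Fin m → E × E) × (Fin m → E) | ∀ i, (z.1 i, z.2 i) ∉ W}
    rw [Set.ofPred_forall]
    refine MeasurableSet.iInter fun i => ?_
    have : Measurable fun z : (Fin m → E × E) × (Fin m → E) => (z.1 i, z.2 i) := by fun_prop
    exact this hW.compl
  have hpres := measurePreserving_arrowProdEquivProdArrow (E × E) E (Fin m)
    (fun _ => μ.prod μ) (fun _ => D)
  have hpre : MeasurableEquiv.arrowProdEquivProdArrow (E × E) E (Fin m) ⁻¹' A =
      Set.univ.pi fun _ => Wᶜ := by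
    ext w
    simp only [Set.mem_preimage, Set.mem_pi, Set.mem_univ, true_imp_iff]
    rfl
  rw [Tester.rejectProb, acceptEvent_additivityTester]
  change ((Measure.pi fun _ : Fin m => μ.prod μ).prod (Measure.pi fun _ : Fin m => D)).real Aᶜ = _
  rw [probReal_compl_eq_one_sub hA, measureReal_def,
    ← hpres.measure_preimage hA.nullMeasurableSet, hpre, Measure.pi_pi, Finset.prod_const,
    Finset.card_univ, Fintype.card_fin, ENNReal.toReal_pow, ← measureReal_def,
    probReal_compl_eq_one_sub hW]

end AdditivityTester

/-! ### Choice of parameters -/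

theorem mainTheorem8 :
    ∃ C K : ℝ, 0 < C ∧ 0 < K ∧
      ∀ (n : ℕ) (α ε R : ℝ), 0 < α → 0 < ε → 1 ≤ R * (n : ℝ) ^ (1.5 : ℝ) →
        ∃ T : Tester n,
          ((T.numQueries + T.numSamples : ℕ) : ℝ) ≤ C / ε ∧
          ∀ (f : EuclideanSpace ℝ (Fin n) → ℝ), Measurable f →
            ∀ (D : Measure (EuclideanSpace ℝ (Fin n))) [IsProbabilityMeasure D],
              IsConcentrated D (ε / 4) R →
                (IsCloseToAdditive f α → T.acceptProb f D = 1) ∧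
                (IsFarFromAdditive f D (K * (R * (n : ℝ) ^ (1.5 : ℝ) * α)) ε →
                  2 / 3 ≤ T.rejectProb f D) := by
  refine ⟨198, 45, by norm_num, by norm_num, fun n α ε R hα hε hRn => ?_⟩
  have hR : 0 < R := by
    by_contra! hR
    have : (0 : ℝ) ≤ (n : ℝ) ^ (1.5 : ℝ) := Real.rpow_nonneg n.cast_nonneg _
    nlinarith
  obtain ⟨μ, hμ, hviol⟩ := exists_law_violationSet_ge n R hR
  by_cases hε1 : ε < 1
  swap
  -- For `ε ≥ 1` no function is far, so zero rounds suffice and respect the bound `C / ε` however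
  -- small it is.
  · refine ⟨additivityTester μ α 0, ?_, fun f hf D _ hD =>
      ⟨acceptProb_additivityTester_of_isCloseToAdditive μ 0 D, fun hfar => ?_⟩⟩
    · change ((0 * 5 + 0 : ℕ) : ℝ) ≤ _
      simp only [zero_mul, add_zero, Nat.cast_zero]
      positivity
    · exact absurd ((hfar 0).trans_le measureReal_le_one) hε1
  -- Then `m * (ε / 16) ≥ 2`, so all rounds pass with probability at most `exp (-2) ≤ 1 / 3`. At six
  -- oracle calls per round, `6 * (32 / ε + 1) ≤ 198 / ε`.
  let m : ℕ := ⌈32 / ε⌉₊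
  refine ⟨additivityTester μ α m, ?_, fun f hf D _ hD =>
    ⟨acceptProb_additivityTester_of_isCloseToAdditive μ m D, fun hfar => ?_⟩⟩
  · have h1 : (m : ℝ) < 32 / ε + 1 := Nat.ceil_lt_add_one (by positivity)
    have h2 : 1 ≤ 1 / ε := by rw [le_div_iff₀ hε]; linarith
    change ((m * 5 + m : ℕ) : ℝ) ≤ _
    push_cast
    rw [div_eq_mul_one_div] at h1 ⊢
    linarith
  · have hfar' : IsFarFromAdditive f D (45 * α) ε := by
      refine fun h => (hfar h).trans_le (measureReal_mono fun p hp => ?_)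
      refine lt_of_le_of_lt ?_ (Set.mem_ofPred.1 hp)
      have := mul_le_mul_of_nonneg_right hRn hα.le
      linarith
    have hν := hviol f α ε D hf hα hε hε1 hD hfar'
    rw [rejectProb_additivityTester μ α m hf D]
    set ν := ((μ.prod μ).prod D).real (violationSet f α)
    have hν1 : ν ≤ 1 := measureReal_le_one
    have hm : 32 / ε ≤ (m : ℝ) := Nat.le_ceil _
    have hmε : 2 ≤ m * (ε / 16) := by
      rw [div_le_iff₀ hε] at hm; linarith
    have h1 : (1 - ν) ^ m ≤ Real.exp (-2) :=
      calc (1 - ν) ^ m ≤ Real.exp (-ν) ^ m := by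
            exact pow_le_pow_left₀ (by linarith) (Real.one_sub_le_exp_neg ν) m
        _ = Real.exp (m * -ν) := (Real.exp_nat_mul _ _).symm
        _ ≤ Real.exp (-2) := by
            refine Real.exp_le_exp.2 ?_
            have := mul_le_mul_of_nonneg_left hν (Nat.cast_nonneg (α := ℝ) m)
            linarith
    have h2 : Real.exp (-2) ≤ 1 / 3 := by
      rw [Real.exp_neg, ← one_div]
      exact one_div_le_one_div_of_le (by norm_num) (by linarith [Real.add_one_le_exp (2 : ℝ)])
    linarith
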